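/- For symmetric matrices let $A\bullet B=\sum_{i,j}A_{ij}B_{ij}$, and let $\mathbb S^n_+$ be the cone of real symmetric positive semidefinite $n\times n$ matrices. Let $A_0(t),\dots,A_m(t)$ be real symmetric $n\times n$ matrices and $b(t)\in\mathbb R^m$, given for $t\ge 0$ and continuous at $t=0$ (from the right). Consider $$(D_t)\qquad \inf_X\{A_0(t)\bullet X : A_k(t)\bullet X=b_k(t)\ (k=1,\dots,m),\ X\in\mathbb S^n_+\},$$ and let $(P)$, $(D)$ be, for $A_k=A_k(0)$ and $b=b(0)$, the problems $$(P)\qquad \sup_{y,Z}\Big\{b^Ty : A_0-\sum_{k=1}^m y_kA_k=Z,\ y\in\mathbb R^m,\ Z\in\mathbb S^n_+\Big\},\qquad (D)=(D_0).$$ $(P)$ is strictly feasible if it has a feasible point $(y,Z)$ with $Z$ positive definite. A face of a convex set $C$ is a convex subset $F\subseteq C$ such that whenever $x_1,x_2\in C$ and the open segment $(x_1,x_2)$ meets $F$, both $x_1,x_2\in F$. The minimal face of a problem $(D_t)$ is the intersection of all faces of $\mathbb S^n_+$ that contain its feasible region. For an $n\times n$ matrix $M$ and $0\le r\le n$ let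 $M_3$ be its right bottom $r\times r$ block, and let $\operatorname{rank}\langle B_1,\dots,B_m\rangle$ be the dimension of the linear span of the matrices $B_1,\dots,B_m$. **Theorem.** Assume that $(D)$ is feasible, $(P)$ is strictly feasible, $A_1,\dots,A_m$ are linearly independent, and that the minimal face of $(D)$ is $$\left\{Q\begin{pmatrix}O&O\\O&X\end{pmatrix}Q^T : X\in\mathbb S^r_+\right\}$$ for some orthogonal matrix $Q$ and some $0\le r\le n$. Suppose further that for some $\delta>0$: 1. $(D_t)$ is feasible for all $t\in[0,\delta]$; 2. for every $t\in[0,\delta]$ there is an orthogonal matrix $Q(t)$ such that $\lim_{t\to0^+}Q(t)=Q$ and the minimal face of $(D_t)$ is $$\left\{Q(t)\begin{pmatrix}O&O\\O&X\end{pmatrix}Q(t)^T : X\in\mathbb S^r_+\right\};$$ 3. for all $t\in[0,\delta]$, $$\operatorname{rank}\langle (Q(t)^TA_1(t)Q(t))_3,\dots,(Q(t)^TA_m(t)Q(t))_3\rangle=\operatorname{rank}\langle (Q^TA_1Q)_3,\dots,(Q^TA_mQ)_3\rangle .$$ Then the optimal value of $(D_t)$ (an extended real number) is finite at $t=0$ and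 continuous at $t=0$ from the right. -/

import Mathlib

open scoped Matrix Topology

/-- The trace inner product of two real square matrices. -/
def matInner {n : ℕ} (A B : Matrix (Fin n) (Fin n) ℝ) : ℝ :=
  ∑ i, ∑ j, A i j * B i j

/-- The cone of real symmetric positive semidefinite matrices (over the reals,
`Matrix.PosSemidef` includes symmetry). -/
def psdCone (n : ℕ) : Set (Matrix (Fin n) (Fin n) ℝ) :=
  {X | X.PosSemidef}

/-- `F` is a face of the convex set `C`: a convex subset of `C` such that whenever the open
segment between two points of `C` meets `F`, both of these points lie in `F`. -/
def IsFaceOf {E : Type*} [AddCommGroup E] [Module ℝ E] (C F : Set E) : Prop :=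
  F ⊆ C ∧ Convex ℝ F ∧
    ∀ x₁ ∈ C, ∀ x₂ ∈ C, (openSegment ℝ x₁ x₂ ∩ F).Nonempty → x₁ ∈ F ∧ x₂ ∈ F

/-- The minimal face of `C` containing `S`: the intersection of all faces of `C` containing `S`. -/
def minimalFace {E : Type*} [AddCommGroup E] [Module ℝ E] (C S : Set E) : Set E :=
  ⋂₀ {F | IsFaceOf C F ∧ S ⊆ F}

/-- The feasible region of `inf {A₀ • X : A_k • X = b_k for all k, X positive semidefinite}`. -/
def dualFeasible {n m : ℕ} (A : Fin m → Matrix (Fin n) (Fin n) ℝ) (b : Fin m → ℝ) :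
    Set (Matrix (Fin n) (Fin n) ℝ) :=
  {X | X ∈ psdCone n ∧ ∀ k, matInner (A k) X = b k}

/-- The optimal value of `inf {A₀ • X : A_k • X = b_k for all k, X positive semidefinite}`, as an
extended real number: `⊤` if there is no feasible point, `⊥` if the problem is unbounded below. -/
noncomputable def dualValue {n m : ℕ} (A₀ : Matrix (Fin n) (Fin n) ℝ)
    (A : Fin m → Matrix (Fin n) (Fin n) ℝ) (b : Fin m → ℝ) : EReal :=
  ⨅ X ∈ dualFeasible A b, ((matInner A₀ X : ℝ) : EReal)

/-- Strict feasibility of `sup {bᵀ y : A₀ - ∑ y_k A_k = Z, Z positive semidefinite}`: there is a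
feasible point `(y, Z)` with `Z` positive definite. -/
def PrimalStrictlyFeasible {n m : ℕ} (A₀ : Matrix (Fin n) (Fin n) ℝ)
    (A : Fin m → Matrix (Fin n) (Fin n) ℝ) : Prop :=
  ∃ (y : Fin m → ℝ) (Z : Matrix (Fin n) (Fin n) ℝ), A₀ - ∑ k, y k • A k = Z ∧ Z.PosDef

/-- The right bottom `r × r` block of an `n × n` matrix. -/
def lowerBlock {n r : ℕ} (hr : r ≤ n) (M : Matrix (Fin n) (Fin n) ℝ) :
    Matrix (Fin r) (Fin r) ℝ :=
  Matrix.of fun i j => M ⟨n - r + i, by omega⟩ ⟨n - r + j, by omega⟩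

/-- The `n × n` matrix with right bottom block `X` and all other entries zero. -/
def padLower {n r : ℕ} (hr : r ≤ n) (X : Matrix (Fin r) (Fin r) ℝ) :
    Matrix (Fin n) (Fin n) ℝ :=
  Matrix.of fun i j =>
    if h : n - r ≤ (i : ℕ) ∧ n - r ≤ (j : ℕ) then
      X ⟨i - (n - r), by omega⟩ ⟨j - (n - r), by omega⟩
    else 0

/-- The set `{Q diag(O, X) Qᵀ : X an r × r positive semidefinite matrix}`. -/
def rotatedFace {n r : ℕ} (hr : r ≤ n) (Q : Matrix (Fin n) (Fin n) ℝ) :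
    Set (Matrix (Fin n) (Fin n) ℝ) :=
  {Y | ∃ X ∈ psdCone r, Y = Q * padLower hr X * Qᵀ}

/-- The dimension of the span of the right bottom blocks of `Qᵀ A_k Q`, `k = 1, …, m`. -/
noncomputable def reducedRank {n m r : ℕ} (hr : r ≤ n) (Q : Matrix (Fin n) (Fin n) ℝ)
    (A : Fin m → Matrix (Fin n) (Fin n) ℝ) : ℕ :=
  Module.finrank ℝ (Submodule.span ℝ (Set.range fun k => lowerBlock hr (Qᵀ * A k * Q)))

/-! Continuity splits into two semicontinuity statements with different sources.

Lower: if `(y, Z)` is strictly feasible for (P), then for `t` near 0 the slack `A₀(t) - ∑ y_k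
A_k(t)` dominates `c • 1` with one `c > 0`. Weak duality then bounds the trace of every feasible
point with bounded objective, so such points accumulate at feasible points of (D)
(`eventually_lt_dualValue`). The same `y` shows that the value at 0 is finite.

Upper: feasible points near a near-optimal one must be produced, although (D) may lack a positive
definite feasible point. Write the minimal face as `U X Uᵀ`, with `U` the last `r` columns of `Q`.
Inside it a positive definite solution exists (`exists_posDef_of_minimalFace_eq`), and it persists
under perturbation even if the reduced constraints `Uᵀ A_k U` are dependent: constant rank keeps a
fixed subfamily a basis of their span, and consistency gives the other equations
(`exists_tendsto_posSemidef_solution`). -/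

open Filter

/-! ### Quantitative positive definiteness and the semidefinite cone -/

section QuadraticForm

variable {n : ℕ}

lemma abs_dotProduct_mulVec_le (E : Matrix (Fin n) (Fin n) ℝ) (v : Fin n → ℝ) :
    |v ⬝ᵥ (E *ᵥ v)| ≤ (∑ i, ∑ j, |E i j|) * (v ⬝ᵥ v) := by
  have hsq : ∀ i, v i ^ 2 ≤ v ⬝ᵥ v := fun i => by
    have := Finset.single_le_sum (f := fun j => v j * v j)
      (fun j _ => mul_self_nonneg (v j)) (Finset.mem_univ i)
    simpa [dotProduct, sq] using this
  have hE : v ⬝ᵥ (E *ᵥ v) = ∑ i, ∑ j, v i * (E i j * v j) := by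
    simp [dotProduct, Matrix.mulVec, Finset.mul_sum]
  rw [hE, Finset.sum_mul]
  refine (Finset.abs_sum_le_sum_abs _ _).trans (Finset.sum_le_sum fun i _ => ?_)
  rw [Finset.sum_mul]
  refine (Finset.abs_sum_le_sum_abs _ _).trans (Finset.sum_le_sum fun j _ => ?_)
  have h1 := hsq i
  have h2 := hsq j
  have h3 : |v i| * |v j| ≤ v ⬝ᵥ v := by
    nlinarith [sq_nonneg (|v i| - |v j|), sq_abs (v i), sq_abs (v j)]
  calc |v i * (E i j * v j)| = |E i j| * (|v i| * |v j|) := by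
        rw [abs_mul, abs_mul]; ring
    _ ≤ _ := mul_le_mul_of_nonneg_left h3 (abs_nonneg _)

lemma Matrix.PosDef.exists_pos_le_dotProduct {M : Matrix (Fin n) (Fin n) ℝ} (hM : M.PosDef) :
    ∃ c : ℝ, 0 < c ∧ ∀ v : Fin n → ℝ, c * (v ⬝ᵥ v) ≤ v ⬝ᵥ (M *ᵥ v) := by
  have hpos : ∀ v : Fin n → ℝ, v ≠ 0 → 0 < v ⬝ᵥ (M *ᵥ v) := fun v hv => by
    simpa using hM.dotProduct_mulVec_pos hv
  let S : Set (Fin n → ℝ) := Metric.sphere 0 1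
  have hS : IsCompact S := isCompact_sphere 0 1
  have hcont : Continuous fun v : Fin n → ℝ => v ⬝ᵥ (M *ᵥ v) := by fun_prop
  have hcont' : Continuous fun v : Fin n → ℝ => v ⬝ᵥ v := by fun_prop
  -- The sphere is empty exactly when `n = 0`.
  rcases S.eq_empty_or_nonempty with hE | hne
  · refine ⟨1, one_pos, fun v => ?_⟩
    rcases eq_or_ne v 0 with rfl | hv
    · simp
    · have : ‖v‖⁻¹ • v ∈ S := by simp [S, norm_smul, hv]
      simp [hE] at this
  obtain ⟨w, hw, hwmin⟩ := hS.exists_isMinOn hne hcont.continuousOn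
  obtain ⟨u, hu, humax⟩ := hS.exists_isMaxOn hne hcont'.continuousOn
  have hw0 : w ≠ 0 := by rintro rfl; simp [S] at hw
  have hu0 : u ≠ 0 := by rintro rfl; simp [S] at hu
  have hd : 0 < u ⬝ᵥ u := by simpa using Matrix.dotProduct_star_self_pos_iff.2 hu0
  -- The sphere is that of the sup norm, on which `v ⬝ᵥ v` is not constant; hence the division by
  -- its maximum.
  refine ⟨(w ⬝ᵥ (M *ᵥ w)) / (u ⬝ᵥ u), div_pos (hpos w hw0) hd, fun v => ?_⟩
  rcases eq_or_ne v 0 with rfl | hv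
  · simp
  have hvS : ‖v‖⁻¹ • v ∈ S := by simp [S, norm_smul, hv]
  have h1 := hwmin hvS
  have h2 := humax hvS
  simp only [Set.mem_ofPred_eq, Matrix.mulVec_smul, smul_dotProduct, dotProduct_smul,
    smul_eq_mul] at h1 h2
  have hn : 0 < ‖v‖⁻¹ := by positivity
  have hk : (w ⬝ᵥ (M *ᵥ w)) / (u ⬝ᵥ u) * (‖v‖⁻¹ * (‖v‖⁻¹ * (v ⬝ᵥ v)))
      ≤ ‖v‖⁻¹ * (‖v‖⁻¹ * (v ⬝ᵥ (M *ᵥ v))) := by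
    refine le_trans ?_ h1
    rw [div_mul_eq_mul_div, div_le_iff₀ hd]
    exact mul_le_mul_of_nonneg_left h2 (hpos w hw0).le
  have : ‖v‖⁻¹ * (‖v‖⁻¹ * ((w ⬝ᵥ (M *ᵥ w)) / (u ⬝ᵥ u) * (v ⬝ᵥ v)))
      ≤ ‖v‖⁻¹ * (‖v‖⁻¹ * (v ⬝ᵥ (M *ᵥ v))) := by linarith
  exact le_of_mul_le_mul_left (le_of_mul_le_mul_left this hn) hn

/-- Half of the coercivity constant of `M` absorbs the perturbation and the other half survives.
That `c` does not depend on `t` is what later bounds traces uniformly. -/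
lemma Matrix.PosDef.eventually_sub_smul_one_posSemidef {α : Type*} {l : Filter α}
    {M : Matrix (Fin n) (Fin n) ℝ} (hM : M.PosDef) {F : α → Matrix (Fin n) (Fin n) ℝ}
    (hF : Tendsto F l (𝓝 M)) (hsymm : ∀ᶠ t in l, (F t).IsSymm) :
    ∃ c : ℝ, 0 < c ∧ ∀ᶠ t in l, (F t - c • (1 : Matrix (Fin n) (Fin n) ℝ)).PosSemidef := by
  obtain ⟨c, hc, hcM⟩ := hM.exists_pos_le_dotProduct
  refine ⟨c / 2, half_pos hc, ?_⟩
  have hlim : Tendsto (fun t => ∑ i, ∑ j, |(F t - M) i j|) l (𝓝 0) := by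
    have hg : Continuous fun N : Matrix (Fin n) (Fin n) ℝ => ∑ i, ∑ j, |(N - M) i j| := by
      fun_prop
    simpa [Function.comp_def] using (hg.tendsto M).comp hF
  filter_upwards [hlim.eventually_lt_const (half_pos hc), hsymm] with t ht hs
  refine Matrix.PosSemidef.of_dotProduct_mulVec_nonneg ?_ fun v => ?_
  · simp only [Matrix.IsHermitian, Matrix.conjTranspose_eq_transpose_of_trivial,
      Matrix.transpose_sub, Matrix.transpose_smul, Matrix.transpose_one, hs.eq]
  · have h1 := abs_le.1 (abs_dotProduct_mulVec_le (F t - M) v)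
    have h2 := hcM v
    have h0 : 0 ≤ v ⬝ᵥ v := Finset.sum_nonneg fun i _ => mul_self_nonneg (v i)
    simp only [Matrix.sub_mulVec, dotProduct_sub, Matrix.smul_mulVec, Matrix.one_mulVec,
      dotProduct_smul, smul_eq_mul, star_trivial] at h1 ⊢
    nlinarith [h1.1, mul_le_mul_of_nonneg_right ht.le h0]

lemma Matrix.PosSemidef.of_sub_smul_one {M : Matrix (Fin n) (Fin n) ℝ} {c : ℝ} (hc : 0 ≤ c)
    (h : (M - c • (1 : Matrix (Fin n) (Fin n) ℝ)).PosSemidef) : M.PosSemidef := by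
  simpa using h.add (Matrix.PosSemidef.one.smul hc)

lemma isClosed_psdCone : IsClosed (psdCone n) := by
  have : psdCone n = {X | Xᵀ = X} ∩ ⋂ v : Fin n → ℝ, {X | 0 ≤ v ⬝ᵥ (X *ᵥ v)} := by
    ext X
    simp [psdCone, Matrix.posSemidef_iff_dotProduct_mulVec, Matrix.IsHermitian]
  rw [this]
  refine (isClosed_eq (by fun_prop) (by fun_prop)).inter (isClosed_iInter fun v => ?_)
  exact isClosed_le (by fun_prop) (by fun_prop)

/-- Testing on `e_i ± e_j` gives `2|X i j| ≤ X i i + X j j`. Hence a trace bound yields compactness.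
-/
lemma Matrix.PosSemidef.abs_apply_le_trace {X : Matrix (Fin n) (Fin n) ℝ} (hX : X.PosSemidef)
    (i j : Fin n) : |X i j| ≤ X.trace := by
  have hsub : ∀ k, X k k ≤ X.trace := fun k =>
    Finset.single_le_sum (f := fun k => X k k) (fun k _ => hX.diag_nonneg) (Finset.mem_univ k)
  have hsym : X j i = X i j := by simpa using hX.1.apply i j
  have hp := hX.dotProduct_mulVec_nonneg (Pi.single i 1 + Pi.single j 1)
  have hm := hX.dotProduct_mulVec_nonneg (Pi.single i 1 - Pi.single j 1)
  simp [Matrix.mulVec_add, Matrix.mulVec_sub, add_dotProduct, sub_dotProduct] at hp hm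
  have h1 := hsub i
  have h2 := hsub j
  rw [abs_le]
  constructor <;> linarith

end QuadraticForm

/-! ### The trace inner product -/

section MatInner

variable {n : ℕ}

lemma matInner_eq_trace (A B : Matrix (Fin n) (Fin n) ℝ) : matInner A B = (Aᵀ * B).trace := by
  simp only [matInner, Matrix.trace, Matrix.diag, Matrix.mul_apply, Matrix.transpose_apply]
  exact Finset.sum_comm

lemma matInner_add_left (A B C : Matrix (Fin n) (Fin n) ℝ) :
    matInner (A + B) C = matInner A C + matInner B C := by
  simp [matInner_eq_trace, Matrix.add_mul]

lemma matInner_sub_left (A B C : Matrix (Fin n) (Fin n) ℝ) :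
    matInner (A - B) C = matInner A C - matInner B C := by
  simp [matInner_eq_trace, Matrix.sub_mul]

lemma matInner_smul_left (c : ℝ) (A B : Matrix (Fin n) (Fin n) ℝ) :
    matInner (c • A) B = c * matInner A B := by
  simp [matInner_eq_trace]

lemma matInner_comm (A B : Matrix (Fin n) (Fin n) ℝ) : matInner A B = matInner B A := by
  simp only [matInner, mul_comm]

lemma matInner_add_right (A B C : Matrix (Fin n) (Fin n) ℝ) :
    matInner A (B + C) = matInner A B + matInner A C := by
  simp [matInner_eq_trace, Matrix.mul_add]

lemma matInner_sub_right (A B C : Matrix (Fin n) (Fin n) ℝ) :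
    matInner A (B - C) = matInner A B - matInner A C := by
  simp [matInner_eq_trace, Matrix.mul_sub]

lemma matInner_smul_right (c : ℝ) (A B : Matrix (Fin n) (Fin n) ℝ) :
    matInner A (c • B) = c * matInner A B := by
  simp [matInner_eq_trace]

lemma matInner_sum_left {ι : Type*} (s : Finset ι) (A : ι → Matrix (Fin n) (Fin n) ℝ)
    (B : Matrix (Fin n) (Fin n) ℝ) :
    matInner (∑ k ∈ s, A k) B = ∑ k ∈ s, matInner (A k) B := by
  simp [matInner_eq_trace, Matrix.transpose_sum, Matrix.sum_mul, Matrix.trace_sum]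

lemma matInner_sum_right {ι : Type*} (s : Finset ι) (A : ι → Matrix (Fin n) (Fin n) ℝ)
    (B : Matrix (Fin n) (Fin n) ℝ) :
    matInner B (∑ k ∈ s, A k) = ∑ k ∈ s, matInner B (A k) := by
  simp only [matInner_comm B, matInner_sum_left]

lemma matInner_self_eq_zero {A : Matrix (Fin n) (Fin n) ℝ} : matInner A A = 0 ↔ A = 0 := by
  rw [matInner_eq_trace, ← Matrix.conjTranspose_eq_transpose_of_trivial,
    Matrix.trace_conjTranspose_mul_self_eq_zero_iff]

lemma matInner_one_left (X : Matrix (Fin n) (Fin n) ℝ) : matInner 1 X = X.trace := by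
  simp [matInner_eq_trace]

/-- Turns constraints on a point `U X Uᵀ` of the face into constraints on the small matrix `X`. -/
lemma matInner_conj {r : ℕ} (A : Matrix (Fin n) (Fin n) ℝ) (U : Matrix (Fin n) (Fin r) ℝ)
    (X : Matrix (Fin r) (Fin r) ℝ) : matInner A (U * X * Uᵀ) = matInner (Uᵀ * A * U) X := by
  rw [matInner_eq_trace, matInner_eq_trace, ← Matrix.mul_assoc, ← Matrix.mul_assoc,
    Matrix.trace_mul_comm]
  simp [Matrix.mul_assoc]

@[fun_prop]
lemma Continuous.matInner {α : Type*} [TopologicalSpace α] {f g : α → Matrix (Fin n) (Fin n) ℝ}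
    (hf : Continuous f) (hg : Continuous g) : Continuous fun x => matInner (f x) (g x) := by
  unfold _root_.matInner
  fun_prop

lemma Filter.Tendsto.matInner {α : Type*} {l : Filter α} {f g : α → Matrix (Fin n) (Fin n) ℝ}
    {a b : Matrix (Fin n) (Fin n) ℝ} (hf : Tendsto f l (𝓝 a)) (hg : Tendsto g l (𝓝 b)) :
    Tendsto (fun x => matInner (f x) (g x)) l (𝓝 (matInner a b)) := by
  refine tendsto_finsetSum _ fun i _ => tendsto_finsetSum _ fun j _ => ?_
  exact ((tendsto_pi_nhds.1 (tendsto_pi_nhds.1 hf i)) j).mul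
    ((tendsto_pi_nhds.1 (tendsto_pi_nhds.1 hg i)) j)

open scoped MatrixOrder Matrix.Norms.L2Operator in
-- Factor `B = Cᴴ C`; the inner product is then the trace of `C A Cᴴ`.
lemma matInner_nonneg {A B : Matrix (Fin n) (Fin n) ℝ} (hA : A.PosSemidef) (hB : B.PosSemidef) :
    0 ≤ matInner A B := by
  obtain ⟨C, rfl⟩ := CStarAlgebra.nonneg_iff_eq_star_mul_self.1 hB.nonneg
  have h := (hA.mul_mul_conjTranspose_same C).trace_nonneg
  rw [matInner_eq_trace, ← Matrix.conjTranspose_eq_transpose_of_trivial, hA.1.eq,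
    ← Matrix.mul_assoc, Matrix.trace_mul_comm, ← Matrix.mul_assoc]
  simpa [Matrix.star_eq_conjTranspose] using h

end MatInner

/-! ### Faces and blocks in terms of `U = Q * lowerEmbedding hr` -/

section BlockEmbedding

variable {n r : ℕ}

/-- The `n × r` matrix embedding `ℝʳ` as the last `r` coordinates of `ℝⁿ`. -/
def lowerEmbedding (hr : r ≤ n) : Matrix (Fin n) (Fin r) ℝ :=
  (1 : Matrix (Fin n) (Fin n) ℝ).submatrix id fun j => ⟨n - r + j, by omega⟩

lemma lowerBlock_eq (hr : r ≤ n) (M : Matrix (Fin n) (Fin n) ℝ) :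
    lowerBlock hr M = (lowerEmbedding hr)ᵀ * M * lowerEmbedding hr := by
  ext i j
  simp [lowerBlock, lowerEmbedding, Matrix.mul_apply, Matrix.one_apply]

lemma padLower_eq (hr : r ≤ n) (X : Matrix (Fin r) (Fin r) ℝ) :
    padLower hr X = lowerEmbedding hr * X * (lowerEmbedding hr)ᵀ := by
  have key : ∀ (f : Fin r → ℝ) (i : Fin n),
      ∑ k : Fin r, lowerEmbedding hr i k * f k =
        if h : n - r ≤ (i : ℕ) then f ⟨i - (n - r), by omega⟩ else 0 := by
    intro f i
    split_ifs with h
    · rw [Finset.sum_eq_single ⟨i - (n - r), by omega⟩]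
      · simp [lowerEmbedding, Matrix.one_apply, h]
      · intro k _ hk
        have : (i : ℕ) ≠ n - r + k := fun h' => hk (Fin.ext (by simp; omega))
        simp [lowerEmbedding, Fin.ext_iff, this]
      · simp
    · refine Finset.sum_eq_zero fun k _ => ?_
      have : (i : ℕ) ≠ n - r + k := by omega
      simp [lowerEmbedding, Fin.ext_iff, this]
  ext i j
  have h2 : ∀ l, (lowerEmbedding hr * X) i l =
      if h : n - r ≤ (i : ℕ) then X ⟨i - (n - r), by omega⟩ l else 0 := fun l => by
    rw [Matrix.mul_apply, key (fun k => X k l) i]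
  rw [Matrix.mul_apply]
  simp only [Matrix.transpose_apply]
  simp_rw [mul_comm ((lowerEmbedding hr * X) i _)]
  rw [key (fun l => (lowerEmbedding hr * X) i l) j]
  simp only [h2, padLower, Matrix.of_apply]
  by_cases hi : n - r ≤ (i : ℕ) <;> by_cases hj : n - r ≤ (j : ℕ) <;> simp [hi, hj]

lemma lowerEmbedding_transpose_mul_self (hr : r ≤ n) :
    (lowerEmbedding hr)ᵀ * lowerEmbedding hr = 1 := by
  rw [← Matrix.mul_one (lowerEmbedding hr)ᵀ, ← lowerBlock_eq]
  ext i j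
  simp [lowerBlock, Matrix.one_apply, Fin.ext_iff]

lemma mem_rotatedFace_iff (hr : r ≤ n) (Q Y : Matrix (Fin n) (Fin n) ℝ) :
    Y ∈ rotatedFace hr Q ↔ ∃ X : Matrix (Fin r) (Fin r) ℝ, X.PosSemidef ∧
      Y = (Q * lowerEmbedding hr) * X * (Q * lowerEmbedding hr)ᵀ := by
  simp [rotatedFace, psdCone, padLower_eq, Matrix.mul_assoc]

lemma lowerBlock_conj (hr : r ≤ n) (Q A : Matrix (Fin n) (Fin n) ℝ) :
    lowerBlock hr (Qᵀ * A * Q) = (Q * lowerEmbedding hr)ᵀ * A * (Q * lowerEmbedding hr) := by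
  simp [lowerBlock_eq, Matrix.mul_assoc]

lemma reducedRank_eq {m : ℕ} (hr : r ≤ n) (Q : Matrix (Fin n) (Fin n) ℝ)
    (A : Fin m → Matrix (Fin n) (Fin n) ℝ) :
    reducedRank hr Q A = Module.finrank ℝ (Submodule.span ℝ
      (Set.range fun k => (Q * lowerEmbedding hr)ᵀ * A k * (Q * lowerEmbedding hr))) := by
  have h : (fun k => lowerBlock hr (Qᵀ * A k * Q)) =
      fun k => (Q * lowerEmbedding hr)ᵀ * A k * (Q * lowerEmbedding hr) :=
    funext fun k => lowerBlock_conj hr Q (A k)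
  rw [reducedRank, h]

lemma mul_lowerEmbedding_transpose_mul_self (hr : r ≤ n) {Q : Matrix (Fin n) (Fin n) ℝ}
    (hQ : Q ∈ Matrix.orthogonalGroup (Fin n) ℝ) :
    (Q * lowerEmbedding hr)ᵀ * (Q * lowerEmbedding hr) = 1 := by
  have h : Qᵀ * Q = 1 := by
    simpa [Matrix.star_eq_conjTranspose] using (Matrix.mem_orthogonalGroup_iff' (Fin n) ℝ).1 hQ
  rw [Matrix.transpose_mul, Matrix.mul_assoc, ← Matrix.mul_assoc Qᵀ, h, Matrix.one_mul,
    lowerEmbedding_transpose_mul_self]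

end BlockEmbedding

/-! ### Minimal faces and relative interior points -/

section Faces

variable {n m r : ℕ}

lemma subset_minimalFace {E : Type*} [AddCommGroup E] [Module ℝ E] (C S : Set E) :
    S ⊆ minimalFace C S :=
  Set.subset_sInter fun _ hF => hF.2

lemma mulVec_eq_zero_of_add {X Y : Matrix (Fin n) (Fin n) ℝ} (hX : X.PosSemidef)
    (hY : Y.PosSemidef) {a b : ℝ} (ha : 0 < a) (hb : 0 < b) {w : Fin n → ℝ}
    (h : (a • X + b • Y) *ᵥ w = 0) : X *ᵥ w = 0 ∧ Y *ᵥ w = 0 := by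
  have hx : 0 ≤ w ⬝ᵥ (X *ᵥ w) := by simpa using hX.dotProduct_mulVec_nonneg w
  have hy : 0 ≤ w ⬝ᵥ (Y *ᵥ w) := by simpa using hY.dotProduct_mulVec_nonneg w
  have hs : a * (w ⬝ᵥ (X *ᵥ w)) + b * (w ⬝ᵥ (Y *ᵥ w)) = 0 := by
    simpa [Matrix.add_mulVec, Matrix.smul_mulVec] using congrArg (w ⬝ᵥ ·) h
  have hx0 : w ⬝ᵥ (X *ᵥ w) = 0 := by
    nlinarith [mul_nonneg ha.le hx, mul_nonneg hb.le hy, mul_pos ha ha]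
  have hy0 : w ⬝ᵥ (Y *ᵥ w) = 0 := by
    nlinarith [mul_nonneg ha.le hx, mul_nonneg hb.le hy, mul_pos ha ha]
  exact ⟨(hX.dotProduct_mulVec_zero_iff w).1 (by simpa using hx0),
    (hY.dotProduct_mulVec_zero_iff w).1 (by simpa using hy0)⟩

/-- Used to test minimality: a vector killed by all feasible points is killed by the whole minimal
face. -/
lemma isFaceOf_psdCone_mulVec_eq_zero (w : Fin n → ℝ) :
    IsFaceOf (psdCone n) {Y | Y ∈ psdCone n ∧ Y *ᵥ w = 0} := by
  refine ⟨fun Y hY => hY.1, ?_, ?_⟩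
  · intro X hX Y hY a b ha hb _
    exact ⟨(hX.1.smul ha).add (hY.1.smul hb), by
      simp [Matrix.add_mulVec, Matrix.smul_mulVec, hX.2, hY.2]⟩
  · rintro X hX Y hY ⟨Z, ⟨a, b, ha, hb, _, rfl⟩, hZ⟩
    obtain ⟨h1, h2⟩ := mulVec_eq_zero_of_add hX hY ha hb hZ.2
    exact ⟨⟨hX, h1⟩, ⟨hY, h2⟩⟩

lemma convex_dualFeasible (A : Fin m → Matrix (Fin n) (Fin n) ℝ) (b : Fin m → ℝ) :
    Convex ℝ (dualFeasible A b) := by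
  intro X hX Y hY s t hs ht hst
  refine ⟨(hX.1.smul hs).add (hY.1.smul ht), fun k => ?_⟩
  rw [matInner_add_right, matInner_smul_right, matInner_smul_right, hX.2, hY.2, ← add_mul, hst,
    one_mul]

/-- A convex set of positive semidefinite matrices has an element whose kernel is contained in
the kernel of every other element. -/
lemma exists_forall_mulVec_eq_zero {S : Set (Matrix (Fin n) (Fin n) ℝ)} (hS : Convex ℝ S)
    (hne : S.Nonempty) (hpsd : S ⊆ psdCone n) :
    ∃ X ∈ S, ∀ Y ∈ S, ∀ w, X *ᵥ w = 0 → Y *ᵥ w = 0 := by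
  let d : Matrix (Fin n) (Fin n) ℝ → ℕ := fun X =>
    Module.finrank ℝ (LinearMap.ker (Matrix.mulVecLin X))
  -- Minimal kernel dimension. The kernel of a midpoint lies in both kernels, so by minimality it
  -- equals that of `X`.
  let X := Function.argminOn d S hne
  have hX : X ∈ S := Function.argminOn_mem d S hne
  refine ⟨X, hX, fun Y hY w hw => ?_⟩
  have hmid : (1 / 2 : ℝ) • X + (1 / 2 : ℝ) • Y ∈ S :=
    hS hX hY (by norm_num) (by norm_num) (by norm_num)
  have hker : ∀ v, ((1 / 2 : ℝ) • X + (1 / 2 : ℝ) • Y) *ᵥ v = 0 → X *ᵥ v = 0 ∧ Y *ᵥ v = 0 :=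
    fun v hv => mulVec_eq_zero_of_add (hpsd hX) (hpsd hY) (by norm_num) (by norm_num) hv
  have hle : LinearMap.ker (Matrix.mulVecLin ((1 / 2 : ℝ) • X + (1 / 2 : ℝ) • Y)) ≤
      LinearMap.ker (Matrix.mulVecLin X) := fun v hv => (hker v hv).1
  have heq := Submodule.eq_of_le_of_finrank_le hle (Function.argminOn_le d S hmid)
  have hwm : w ∈ LinearMap.ker (Matrix.mulVecLin X) := hw
  rw [← heq] at hwm
  exact (hker w hwm).2

/-- If the minimal face of a feasible problem is `{U X Uᵀ : X ⪰ 0}`, then some feasible point is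
`U X Uᵀ` with `X` positive definite. -/
lemma exists_posDef_of_minimalFace_eq {A : Fin m → Matrix (Fin n) (Fin n) ℝ} {b : Fin m → ℝ}
    (hne : (dualFeasible A b).Nonempty) {U : Matrix (Fin n) (Fin r) ℝ} (hU : Uᵀ * U = 1)
    (hface : ∀ Y, Y ∈ minimalFace (psdCone n) (dualFeasible A b) ↔
      ∃ X : Matrix (Fin r) (Fin r) ℝ, X.PosSemidef ∧ Y = U * X * Uᵀ) :
    ∃ X : Matrix (Fin r) (Fin r) ℝ, X.PosDef ∧ U * X * Uᵀ ∈ dualFeasible A b := by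
  obtain ⟨Y, hY, hYker⟩ := exists_forall_mulVec_eq_zero (convex_dualFeasible A b) hne
    fun X hX => hX.1
  obtain ⟨X, hX, rfl⟩ := (hface Y).1 (subset_minimalFace _ _ hY)
  refine ⟨X, Matrix.PosDef.of_dotProduct_mulVec_pos hX.1 fun {v} hv => ?_, hY⟩
  refine lt_of_le_of_ne (hX.dotProduct_mulVec_nonneg v) fun h0 => hv ?_
  have hXv : X *ᵥ v = 0 := (hX.dotProduct_mulVec_zero_iff v).1 h0.symm
  have hcancel : ∀ M : Matrix (Fin r) (Fin r) ℝ, (U * M * Uᵀ) *ᵥ (U *ᵥ v) = U *ᵥ (M *ᵥ v) := by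
    intro M
    simp only [Matrix.mulVec_mulVec, Matrix.mul_assoc, hU, Matrix.mul_one]
  have hsub : minimalFace (psdCone n) (dualFeasible A b) ⊆
      {Y | Y ∈ psdCone n ∧ Y *ᵥ (U *ᵥ v) = 0} :=
    Set.sInter_subset_of_mem ⟨isFaceOf_psdCone_mulVec_eq_zero _, fun Z hZ =>
      ⟨hZ.1, hYker Z hZ _ (by rw [hcancel, hXv, Matrix.mulVec_zero])⟩⟩
  -- `U Uᵀ` lies in the minimal face, hence kills `U v`; but `U Uᵀ U v = U v`, so `v = 0`.
  have hone := (hsub ((hface _).2 ⟨1, Matrix.PosSemidef.one, rfl⟩)).2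
  rw [hcancel, Matrix.one_mulVec] at hone
  simpa [Matrix.mulVec_mulVec, hU] using congrArg (Uᵀ *ᵥ ·) hone

end Faces

/-! ### Perturbing linear systems of constant rank -/

section ConstantRank

variable {r m : ℕ} {κ : Type*} [Fintype κ]

/-- The Gram matrix of a family of matrices with respect to the trace inner product. -/
def matGram (C : κ → Matrix (Fin r) (Fin r) ℝ) : Matrix κ κ ℝ :=
  Matrix.of fun i j => matInner (C i) (C j)

lemma matGram_mulVec (C : κ → Matrix (Fin r) (Fin r) ℝ) (v : κ → ℝ) (i : κ) :
    (matGram C *ᵥ v) i = matInner (C i) (∑ j, v j • C j) := by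
  simp [matGram, Matrix.mulVec, dotProduct, matInner_sum_right, matInner_smul_right, mul_comm]

/-- A kernel vector of the Gram matrix gives a combination orthogonal to every `C i`, hence to
itself. Independence thus becomes an open condition. -/
lemma linearIndependent_iff_det_matGram_ne_zero [DecidableEq κ]
    (C : κ → Matrix (Fin r) (Fin r) ℝ) :
    LinearIndependent ℝ C ↔ (matGram C).det ≠ 0 := by
  rw [Fintype.linearIndependent_iff, ← not_iff_not, not_not, ← Matrix.exists_mulVec_eq_zero_iff]
  push Not
  constructor
  · rintro ⟨g, hg, i, hi⟩
    refine ⟨g, fun h => hi (by simp [h]), ?_⟩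
    ext k
    rw [matGram_mulVec, hg]
    simp [matInner]
  · rintro ⟨v, hv, hv0⟩
    refine ⟨v, ?_, Function.ne_iff.1 hv⟩
    rw [← matInner_self_eq_zero, matInner_sum_left]
    refine Finset.sum_eq_zero fun i _ => ?_
    rw [matInner_smul_left, ← matGram_mulVec, hv0]
    simp

/-- A positive definite solution of a consistent linear system of symmetric matrix equations
persists under perturbations that keep the system consistent and its rank constant. -/
lemma exists_tendsto_posSemidef_solution {α : Type*} {l : Filter α}
    {B : α → Fin m → Matrix (Fin r) (Fin r) ℝ} {B₀ : Fin m → Matrix (Fin r) (Fin r) ℝ}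
    {b : α → Fin m → ℝ} {b₀ : Fin m → ℝ}
    (hB : ∀ k, Tendsto (fun t => B t k) l (𝓝 (B₀ k)))
    (hb : ∀ k, Tendsto (fun t => b t k) l (𝓝 (b₀ k)))
    (hsymm : ∀ᶠ t in l, ∀ k, (B t k).IsSymm)
    (hrank : ∀ᶠ t in l, Module.finrank ℝ (Submodule.span ℝ (Set.range (B t))) =
      Module.finrank ℝ (Submodule.span ℝ (Set.range B₀)))
    (hcons : ∀ᶠ t in l, ∃ Y, ∀ k, matInner (B t k) Y = b t k)
    {X₀ : Matrix (Fin r) (Fin r) ℝ} (hX₀ : X₀.PosDef)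
    (hsol : ∀ k, matInner (B₀ k) X₀ = b₀ k) :
    ∃ X : α → Matrix (Fin r) (Fin r) ℝ, Tendsto X l (𝓝 X₀) ∧
      ∀ᶠ t in l, (X t).PosSemidef ∧ ∀ k, matInner (B t k) (X t) = b t k := by
  classical
  obtain ⟨κ, a, ha, hspan, hli⟩ := exists_linearIndependent' ℝ B₀
  have : Fintype κ := Fintype.ofInjective a ha
  set G : α → Matrix κ κ ℝ := fun t => matGram (B t ∘ a) with hG
  set G₀ : Matrix κ κ ℝ := matGram (B₀ ∘ a) with hG₀
  have hGlim : Tendsto G l (𝓝 G₀) := tendsto_pi_nhds.2 fun i => tendsto_pi_nhds.2 fun j =>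
    (hB (a i)).matInner (hB (a j))
  have hdet₀ : G₀.det ≠ 0 := (linearIndependent_iff_det_matGram_ne_zero _).1 hli
  have hdetlim : Tendsto (fun t => (G t).det) l (𝓝 G₀.det) :=
    ((continuous_id.matrix_det).tendsto G₀).comp hGlim
  have hadjlim : Tendsto (fun t => (G t).adjugate) l (𝓝 G₀.adjugate) :=
    ((continuous_id.matrix_adjugate).tendsto G₀).comp hGlim
  have hdet : ∀ᶠ t in l, (G t).det ≠ 0 := hdetlim.eventually_ne hdet₀
  set e : α → κ → ℝ := fun t i => b t (a i) - matInner (B t (a i)) X₀ with he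
  have helim : Tendsto e l (𝓝 0) := tendsto_pi_nhds.2 fun i => by
    have := (hb (a i)).sub ((hB (a i)).matInner (tendsto_const_nhds (x := X₀)))
    simpa [hsol] using this
  set c : α → κ → ℝ := fun t => (G t).det⁻¹ • ((G t).adjugate *ᵥ e t) with hc
  have hclim : Tendsto c l (𝓝 0) := by
    have hmv : Continuous fun p : Matrix κ κ ℝ × (κ → ℝ) => p.1 *ᵥ p.2 := by fun_prop
    have h1 := (hmv.tendsto (G₀.adjugate, 0)).comp (hadjlim.prodMk_nhds helim)
    simpa using (hdetlim.inv₀ hdet₀).smul h1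
  have hGc : ∀ t, (G t).det ≠ 0 → G t *ᵥ c t = e t := fun t ht => by
    simp only [hc]
    rw [Matrix.mulVec_smul, Matrix.mulVec_mulVec, Matrix.mul_adjugate, Matrix.smul_mulVec,
      Matrix.one_mulVec, smul_smul, inv_mul_cancel₀ ht, one_smul]
  set X : α → Matrix (Fin r) (Fin r) ℝ := fun t => X₀ + ∑ i, c t i • B t (a i) with hX
  have hXlim : Tendsto X l (𝓝 X₀) := by
    have h1 : Tendsto (fun t => ∑ i, c t i • B t (a i)) l (𝓝 (∑ i : κ, (0 : ℝ) • B₀ (a i))) :=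
      tendsto_finsetSum _ fun i _ => (tendsto_pi_nhds.1 hclim i).smul (hB (a i))
    simpa using (tendsto_const_nhds (x := X₀)).add h1
  have hXsymm : ∀ᶠ t in l, (X t).IsSymm := by
    filter_upwards [hsymm] with t ht
    have h0 : X₀ᵀ = X₀ := by simpa using hX₀.1.eq
    simp only [Matrix.IsSymm, hX, Matrix.transpose_add, Matrix.transpose_sum,
      Matrix.transpose_smul, h0, (ht _).eq]
  refine ⟨X, hXlim, ?_⟩
  obtain ⟨ε, hε, hpsd⟩ := hX₀.eventually_sub_smul_one_posSemidef hXlim hXsymm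
  filter_upwards [hpsd, hdet, hrank, hcons] with t htpsd htdet htrank htcons
  refine ⟨.of_sub_smul_one hε.le htpsd, ?_⟩
  obtain ⟨Y, hY⟩ := htcons
  -- Comparing with an arbitrary solution `Y` makes the equations homogeneous, so they extend from
  -- the basis to its span.
  have hbase : ∀ i, matInner (B t (a i)) (X t - Y) = 0 := fun i => by
    have h1 := congrFun (hGc t htdet) i
    simp only [hG, matGram_mulVec, he, Function.comp_apply] at h1
    rw [matInner_sub_right, hY, hX, matInner_add_right, h1]
    ring
  have hlit : LinearIndependent ℝ (B t ∘ a) :=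
    (linearIndependent_iff_det_matGram_ne_zero _).2 htdet
  -- Constant rank enters here: the subfamily chosen at the limit still spans.
  have hspan_t : Submodule.span ℝ (Set.range (B t ∘ a)) = Submodule.span ℝ (Set.range (B t)) := by
    refine Submodule.eq_of_le_of_finrank_eq (Submodule.span_mono (Set.range_comp_subset_range _ _))
      ?_
    rw [htrank, ← hspan, finrank_span_eq_card hlit, finrank_span_eq_card hli]
  have hall : ∀ M ∈ Submodule.span ℝ (Set.range (B t)), matInner M (X t - Y) = 0 := by
    rw [← hspan_t]
    intro M hM
    induction hM using Submodule.span_induction with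
    | mem M hM => obtain ⟨i, rfl⟩ := hM; exact hbase i
    | zero => simp [matInner]
    | add M N _ _ hM hN => rw [matInner_add_left, hM, hN, add_zero]
    | smul s M _ hM => rw [matInner_smul_left, hM, mul_zero]
  intro k
  have := hall (B t k) (Submodule.subset_span ⟨k, rfl⟩)
  rw [matInner_sub_right, hY] at this
  linarith

end ConstantRank

/-! ### Semicontinuity of the optimal value -/

section Semicontinuity

lemma Filter.Tendsto.matrix_mul {α p q s : Type*} [Fintype q] {l : Filter α}
    {f : α → Matrix p q ℝ} {g : α → Matrix q s ℝ} {M : Matrix p q ℝ} {N : Matrix q s ℝ}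
    (hf : Tendsto f l (𝓝 M)) (hg : Tendsto g l (𝓝 N)) :
    Tendsto (fun t => f t * g t) l (𝓝 (M * N)) :=
  tendsto_pi_nhds.2 fun i => tendsto_pi_nhds.2 fun j => tendsto_finsetSum _ fun k _ =>
    (tendsto_pi_nhds.1 (tendsto_pi_nhds.1 hf i) k).mul
      (tendsto_pi_nhds.1 (tendsto_pi_nhds.1 hg k) j)

lemma Filter.Tendsto.matrix_transpose {α p q : Type*} {l : Filter α} {f : α → Matrix p q ℝ}
    {M : Matrix p q ℝ} (hf : Tendsto f l (𝓝 M)) : Tendsto (fun t => (f t)ᵀ) l (𝓝 Mᵀ) :=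
  tendsto_pi_nhds.2 fun i => tendsto_pi_nhds.2 fun j =>
    tendsto_pi_nhds.1 (tendsto_pi_nhds.1 hf j) i

variable {n m r : ℕ}

lemma dualValue_le {A₀ : Matrix (Fin n) (Fin n) ℝ} {A : Fin m → Matrix (Fin n) (Fin n) ℝ}
    {b : Fin m → ℝ} {X : Matrix (Fin n) (Fin n) ℝ} (hX : X ∈ dualFeasible A b) :
    dualValue A₀ A b ≤ (matInner A₀ X : ℝ) :=
  iInf₂_le X hX

/-- Weak duality with margin `c`: `c = 0` bounds the value below, `c > 0` bounds the trace. -/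
lemma le_matInner_of_posSemidef {A₀ : Matrix (Fin n) (Fin n) ℝ}
    {A : Fin m → Matrix (Fin n) (Fin n) ℝ} {b : Fin m → ℝ} {y : Fin m → ℝ} {c : ℝ}
    (hZ : (A₀ - ∑ k, y k • A k - c • (1 : Matrix (Fin n) (Fin n) ℝ)).PosSemidef)
    {X : Matrix (Fin n) (Fin n) ℝ} (hX : X ∈ dualFeasible A b) :
    ∑ k, y k * b k + c * X.trace ≤ matInner A₀ X := by
  have h := matInner_nonneg hZ hX.1
  simp only [matInner_sub_left, matInner_sum_left, matInner_smul_left, matInner_one_left,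
    hX.2] at h
  linarith

variable {α : Type*} {l : Filter α} {A₀ : α → Matrix (Fin n) (Fin n) ℝ}
  {A : α → Fin m → Matrix (Fin n) (Fin n) ℝ} {b : α → Fin m → ℝ}
  {A₀' : Matrix (Fin n) (Fin n) ℝ} {A' : Fin m → Matrix (Fin n) (Fin n) ℝ} {b' : Fin m → ℝ}

/-- Lower semicontinuity of the optimal value under strict feasibility of `(P)`. -/
lemma eventually_lt_dualValue [l.IsCountablyGenerated] (hA₀ : Tendsto A₀ l (𝓝 A₀'))
    (hA : ∀ k, Tendsto (fun t => A t k) l (𝓝 (A' k)))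
    (hb : ∀ k, Tendsto (fun t => b t k) l (𝓝 (b' k)))
    (hA₀_symm : ∀ᶠ t in l, (A₀ t).IsSymm) (hA_symm : ∀ᶠ t in l, ∀ k, (A t k).IsSymm)
    (hP : PrimalStrictlyFeasible A₀' A') {a : EReal} (ha : a < dualValue A₀' A' b') :
    ∀ᶠ t in l, a < dualValue (A₀ t) (A t) (b t) := by
  obtain ⟨s, has, hs⟩ := EReal.lt_iff_exists_real_btwn.1 ha
  suffices h : ∀ᶠ t in l, ∀ X ∈ dualFeasible (A t) (b t), s < matInner (A₀ t) X by
    filter_upwards [h] with t ht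
    exact has.trans_le (le_iInf₂ fun X hX => by exact_mod_cast (ht X hX).le)
  obtain ⟨y, Z, hyZ, hZ⟩ := hP
  have hZlim : Tendsto (fun t => A₀ t - ∑ k, y k • A t k) l (𝓝 Z) := by
    rw [← hyZ]
    exact hA₀.sub (tendsto_finsetSum _ fun k _ => (hA k).const_smul (y k))
  have hZsymm : ∀ᶠ t in l, (A₀ t - ∑ k, y k • A t k).IsSymm := by
    filter_upwards [hA₀_symm, hA_symm] with t h0 hk
    simp only [Matrix.IsSymm, Matrix.transpose_sub, Matrix.transpose_sum, Matrix.transpose_smul,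
      h0.eq, (hk _).eq]
  obtain ⟨c, hc, hpsd⟩ := hZ.eventually_sub_smul_one_posSemidef hZlim hZsymm
  have hblim : Tendsto (fun t => ∑ k, y k * b t k) l (𝓝 (∑ k, y k * b' k)) :=
    tendsto_finsetSum _ fun k _ => (hb k).const_mul (y k)
  have hblow := hblim.eventually_const_lt (sub_one_lt (∑ k, y k * b' k))
  by_contra hcon
  rw [Filter.not_eventually] at hcon
  obtain ⟨u, hu, hup⟩ := exists_seq_forall_of_frequently (hcon.and_eventually (hpsd.and hblow))
  have hex : ∀ i, ∃ X ∈ dualFeasible (A (u i)) (b (u i)), matInner (A₀ (u i)) X ≤ s := fun i => by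
    have := (hup i).1
    push Not at this
    exact this
  choose X hXf hXs using hex
  -- The trace bound from weak duality: the objective is at most `s`, and `hblow` costs the `1`.
  set M : ℝ := (s - (∑ k, y k * b' k - 1)) / c with hM
  have hbound : ∀ i, X i ∈ Set.univ.pi fun _ : Fin n => Set.univ.pi fun _ : Fin n =>
      Set.Icc (-M) M := by
    intro i p _ q _
    have h1 := le_matInner_of_posSemidef (hup i).2.1 (hXf i)
    have h2 := (hup i).2.2
    have h3 : (X i).trace ≤ M := by
      rw [hM, le_div_iff₀ hc]
      linarith [hXs i]
    exact abs_le.1 (((hXf i).1.abs_apply_le_trace p q).trans h3)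
  have hcomp : IsCompact (Set.univ.pi fun _ : Fin n => Set.univ.pi fun _ : Fin n =>
      Set.Icc (-M) M) :=
    isCompact_univ_pi fun _ => isCompact_univ_pi fun _ => isCompact_Icc
  obtain ⟨Y, -, φ, hφ, hY⟩ := hcomp.tendsto_subseq hbound
  have huφ : Tendsto (u ∘ φ) atTop l := hu.comp hφ.tendsto_atTop
  have hYf : Y ∈ dualFeasible A' b' := by
    refine ⟨isClosed_psdCone.mem_of_tendsto hY (Eventually.of_forall fun i => (hXf (φ i)).1),
      fun k => ?_⟩
    refine tendsto_nhds_unique (((hA k).comp huφ).matInner hY) ?_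
    refine ((hb k).comp huφ).congr fun i => ?_
    exact ((hXf (φ i)).2 k).symm
  have hYs : matInner A₀' Y ≤ s :=
    le_of_tendsto ((hA₀.comp huφ).matInner hY) (Eventually.of_forall fun i => hXs (φ i))
  exact absurd (hs.trans_le (dualValue_le hYf)) (not_lt.2 (by exact_mod_cast hYs))

/-- Upper semicontinuity of the optimal value when the reduced constraint systems have constant
rank. -/
lemma eventually_dualValue_lt {U : α → Matrix (Fin n) (Fin r) ℝ} {U' : Matrix (Fin n) (Fin r) ℝ}
    (hA₀ : Tendsto A₀ l (𝓝 A₀')) (hA : ∀ k, Tendsto (fun t => A t k) l (𝓝 (A' k)))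
    (hb : ∀ k, Tendsto (fun t => b t k) l (𝓝 (b' k))) (hU : Tendsto U l (𝓝 U'))
    (hA_symm : ∀ᶠ t in l, ∀ k, (A t k).IsSymm)
    (hrank : ∀ᶠ t in l,
      Module.finrank ℝ (Submodule.span ℝ (Set.range fun k => (U t)ᵀ * A t k * U t)) =
        Module.finrank ℝ (Submodule.span ℝ (Set.range fun k => U'ᵀ * A' k * U')))
    (hfeas : ∀ᶠ t in l, ∃ X : Matrix (Fin r) (Fin r) ℝ, U t * X * (U t)ᵀ ∈ dualFeasible (A t) (b t))
    (hrep : ∀ Y ∈ dualFeasible A' b', ∃ X : Matrix (Fin r) (Fin r) ℝ, X.PosSemidef ∧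
      Y = U' * X * U'ᵀ)
    {W : Matrix (Fin r) (Fin r) ℝ} (hW : W.PosDef) (hWf : U' * W * U'ᵀ ∈ dualFeasible A' b')
    {a : EReal} (ha : dualValue A₀' A' b' < a) :
    ∀ᶠ t in l, dualValue (A₀ t) (A t) (b t) < a := by
  obtain ⟨Y, hY⟩ := iInf_lt_iff.1 ha
  obtain ⟨hYf, hYa⟩ := iInf_lt_iff.1 hY
  obtain ⟨V, hV, rfl⟩ := hrep Y hYf
  -- move from `V` slightly towards `W` to become positive definite
  have hline : Tendsto (fun s : ℝ => ((matInner A₀' (U' * (V + s • (W - V)) * U'ᵀ) : ℝ) : EReal))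
      (𝓝[>] 0) (𝓝 (matInner A₀' (U' * V * U'ᵀ) : ℝ)) := by
    have hcont : Continuous fun s : ℝ => matInner A₀' (U' * (V + s • (W - V)) * U'ᵀ) := by
      fun_prop
    have h0 := (continuous_coe_real_ereal.comp hcont).tendsto 0
    simp only [Function.comp_apply, zero_smul, add_zero] at h0
    exact h0.mono_left nhdsWithin_le_nhds
  obtain ⟨s, hsa, hs0, hs1⟩ := ((hline.eventually_lt_const hYa).and
    (Ioo_mem_nhdsGT (zero_lt_one' ℝ))).exists
  set X₀ := V + s • (W - V) with hX₀
  have hX₀eq : X₀ = s • W + (1 - s) • V := by rw [hX₀]; module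
  have hX₀pd : X₀.PosDef := by
    rw [hX₀eq]
    exact (hW.smul hs0).add_posSemidef (hV.smul (sub_pos.2 hs1).le)
  have hX₀sol : ∀ k, matInner (U'ᵀ * A' k * U') X₀ = b' k := fun k => by
    have h1 := hWf.2 k
    have h2 := hYf.2 k
    rw [matInner_conj] at h1 h2
    rw [hX₀eq, matInner_add_right, matInner_smul_right, matInner_smul_right, h1, h2]
    ring
  obtain ⟨X, hXlim, hX⟩ := exists_tendsto_posSemidef_solution
    (B := fun t k => (U t)ᵀ * A t k * U t) (B₀ := fun k => U'ᵀ * A' k * U')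
    (fun k => (hU.matrix_transpose.matrix_mul (hA k)).matrix_mul hU) hb
    (by
      filter_upwards [hA_symm] with t ht k
      simp only [Matrix.IsSymm, Matrix.transpose_mul, Matrix.transpose_transpose, (ht k).eq,
        Matrix.mul_assoc])
    hrank
    -- Consistency alone is needed, so the solution `Y` need not be semidefinite.
    (by
      filter_upwards [hfeas] with t ⟨Y, hY⟩
      exact ⟨Y, fun k => by rw [← matInner_conj]; exact hY.2 k⟩)
    hX₀pd hX₀sol
  have hval : Tendsto (fun t => ((matInner (A₀ t) (U t * X t * (U t)ᵀ) : ℝ) : EReal)) l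
      (𝓝 (matInner A₀' (U' * X₀ * U'ᵀ) : ℝ)) := by
    have h1 := (hU.matrix_mul hXlim).matrix_mul hU.matrix_transpose
    exact (continuous_coe_real_ereal.tendsto _).comp (hA₀.matInner h1)
  filter_upwards [hX, hval.eventually_lt_const hsa] with t ht hta
  refine (dualValue_le ⟨?_, fun k => ?_⟩).trans_lt hta
  · simpa [psdCone] using ht.1.mul_mul_conjTranspose_same (U t)
  · rw [matInner_conj]
    exact ht.2 k

end Semicontinuity

/-! ### Finiteness and right continuity -/

theorem theorem3p1 {n m r : ℕ} (hr : r ≤ n)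
    -- the data; the unperturbed problem is the one at `t = 0`
    (A₀ : ℝ → Matrix (Fin n) (Fin n) ℝ)
    (A : ℝ → Fin m → Matrix (Fin n) (Fin n) ℝ)
    (b : ℝ → Fin m → ℝ)
    (δ : ℝ) (hδ : 0 < δ)
    (hA₀_symm : ∀ t ∈ Set.Icc 0 δ, (A₀ t).IsSymm)
    (hA_symm : ∀ t ∈ Set.Icc 0 δ, ∀ k, (A t k).IsSymm)
    (hA₀_cont : ContinuousWithinAt A₀ (Set.Ici 0) 0)
    (hA_cont : ContinuousWithinAt A (Set.Ici 0) 0)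
    (hb_cont : ContinuousWithinAt b (Set.Ici 0) 0)
    -- conditions on the unperturbed problem
    (hD : (dualFeasible (A 0) (b 0)).Nonempty)
    (hP : PrimalStrictlyFeasible (A₀ 0) (A 0))
    (hA_indep : LinearIndependent ℝ (A 0))
    (Q₀ : Matrix (Fin n) (Fin n) ℝ)
    (hQ₀ : Q₀ ∈ Matrix.orthogonalGroup (Fin n) ℝ)
    (hface₀ : minimalFace (psdCone n) (dualFeasible (A 0) (b 0)) = rotatedFace hr Q₀)
    -- conditions on the perturbed problems
    (hDt : ∀ t ∈ Set.Icc 0 δ, (dualFeasible (A t) (b t)).Nonempty)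
    (Q : ℝ → Matrix (Fin n) (Fin n) ℝ)
    (hQ : ∀ t ∈ Set.Icc 0 δ, Q t ∈ Matrix.orthogonalGroup (Fin n) ℝ)
    (hQ_lim : Filter.Tendsto Q (𝓝[>] 0) (𝓝 Q₀))
    (hface : ∀ t ∈ Set.Icc 0 δ,
      minimalFace (psdCone n) (dualFeasible (A t) (b t)) = rotatedFace hr (Q t))
    (hrank : ∀ t ∈ Set.Icc 0 δ, reducedRank hr (Q t) (A t) = reducedRank hr Q₀ (A 0)) :
    (∃ v : ℝ, dualValue (A₀ 0) (A 0) (b 0) = (v : EReal)) ∧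
      ContinuousWithinAt (fun t => dualValue (A₀ t) (A t) (b t)) (Set.Ici 0) 0 := by

  have hle : 𝓝[>] (0 : ℝ) ≤ 𝓝[Set.Ici 0] 0 := nhdsWithin_mono _ Set.Ioi_subset_Ici_self
  have hmem : ∀ᶠ t in 𝓝[>] (0 : ℝ), t ∈ Set.Icc 0 δ := by
    filter_upwards [Ioo_mem_nhdsGT hδ] with t ht
    exact ⟨ht.1.le, ht.2.le⟩
  have hA₀' : Filter.Tendsto A₀ (𝓝[>] 0) (𝓝 (A₀ 0)) := hA₀_cont.mono_left hle
  have hA' : ∀ k, Filter.Tendsto (fun t => A t k) (𝓝[>] 0) (𝓝 (A 0 k)) := fun k =>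
    tendsto_pi_nhds.1 (hA_cont.mono_left hle) k
  have hb' : ∀ k, Filter.Tendsto (fun t => b t k) (𝓝[>] 0) (𝓝 (b 0 k)) := fun k =>
    tendsto_pi_nhds.1 (hb_cont.mono_left hle) k
  have h0 : (0 : ℝ) ∈ Set.Icc 0 δ := ⟨le_rfl, hδ.le⟩
  refine ⟨?_, ?_⟩
  · obtain ⟨X, hX⟩ := hD
    obtain ⟨y, Z, hyZ, hZ⟩ := hP
    have hlow : ((∑ k, y k * b 0 k : ℝ) : EReal) ≤ dualValue (A₀ 0) (A 0) (b 0) := by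
      refine le_iInf₂ fun Y hY => ?_
      have hZ' : (A₀ 0 - ∑ k, y k • A 0 k - (0 : ℝ) • (1 : Matrix (Fin n) (Fin n) ℝ)).PosSemidef := by
        rw [hyZ, zero_smul, sub_zero]
        exact hZ.posSemidef
      have := le_matInner_of_posSemidef hZ' hY
      rw [zero_mul, add_zero] at this
      exact_mod_cast this
    have hbot : dualValue (A₀ 0) (A 0) (b 0) ≠ ⊥ := ((EReal.bot_lt_coe _).trans_le hlow).ne'
    have htop : dualValue (A₀ 0) (A 0) (b 0) ≠ ⊤ :=
      ((dualValue_le hX).trans_lt (EReal.coe_lt_top _)).ne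
    exact ⟨_, (EReal.coe_toReal htop hbot).symm⟩
  -- Dropping `t = 0` matters: `Q t → Q₀` is assumed only for `t > 0`, and `Q 0` may differ from
  -- `Q₀`.
  · rw [← continuousWithinAt_Ioi_iff_Ici]
    set J := lowerEmbedding hr
    have hmf : ∀ Y, Y ∈ minimalFace (psdCone n) (dualFeasible (A 0) (b 0)) ↔
        ∃ X : Matrix (Fin r) (Fin r) ℝ, X.PosSemidef ∧ Y = (Q₀ * J) * X * (Q₀ * J)ᵀ := fun Y => by
      rw [hface₀, mem_rotatedFace_iff]
    obtain ⟨W, hW, hWf⟩ := exists_posDef_of_minimalFace_eq hD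
      (mul_lowerEmbedding_transpose_mul_self hr hQ₀) hmf
    have hU : Filter.Tendsto (fun t => Q t * J) (𝓝[>] 0) (𝓝 (Q₀ * J)) := by
      exact hQ_lim.matrix_mul tendsto_const_nhds
    refine tendsto_order.2 ⟨fun a ha => ?_, fun a ha => ?_⟩
    · exact eventually_lt_dualValue hA₀' hA' hb' (hmem.mono hA₀_symm) (hmem.mono hA_symm) hP ha
    · refine eventually_dualValue_lt hA₀' hA' hb' hU (hmem.mono hA_symm) ?_ ?_
        (fun Y hY => (hmf Y).1 (subset_minimalFace _ _ hY)) hW hWf ha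
      · filter_upwards [hmem] with t ht
        have h := hrank t ht
        rw [reducedRank_eq, reducedRank_eq] at h
        exact h
      · filter_upwards [hmem] with t ht
        obtain ⟨Y, hY⟩ := hDt t ht
        have hYr := subset_minimalFace (psdCone n) _ hY
        rw [hface t ht, mem_rotatedFace_iff] at hYr
        obtain ⟨X, -, rfl⟩ := hYr
        exact ⟨X, hY⟩
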